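/- For $\boldsymbol\alpha\in\mathbb{R}^m$ let $\dim_{\mathbb{Q}}(\boldsymbol\alpha)$ denote the dimension of the $\mathbb{Q}$-vector space generated by the coordinates of $\boldsymbol\alpha$. For $n,m\in\mathbb{Z}_{\ge 0}$ with $n\le m$, let $\overline{\varepsilon}(n,m)$ be the supremum of all $\varepsilon\in[0,1/2]$ with the following property: for every $\boldsymbol u_0\in\mathbb{R}^m$ and every $\boldsymbol\alpha\in(\mathbb{R}\setminus\{0\})^m$ with $\dim_{\mathbb{Q}}(\boldsymbol\alpha)\ge m-n$, the line $\{\boldsymbol u_0+t\boldsymbol\alpha : t\in\mathbb{R}\}$ intersects $[\varepsilon,1-\varepsilon]^m+\mathbb{Z}^m$ (that is, the view from $\boldsymbol u_0$ with direction $\boldsymbol\alpha$ is obstructed by $[\varepsilon,1-\varepsilon]^m+\mathbb{Z}^m$). Let $n,m\in\mathbb{Z}_{\ge 0}$ be such that $n\le m$. Then: (i) $\overline{\varepsilon}(n,m+1)\le\overline{\varepsilon}(n,m)$; (ii) if $n<m$, then $\overline{\varepsilon}(n,m)=\dfrac{1}{2(n+1)}$. -/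

import Mathlib

/-- `dim_ℚ(α)`: the dimension of the `ℚ`-vector space generated by the coordinates of `α`. -/
noncomputable def ratDim {m : ℕ} (α : Fin m → ℝ) : ℕ :=
  Module.finrank ℚ (Submodule.span ℚ (Set.range α))

/-- The view from `u` with direction `α` is obstructed by `[ε, 1 - ε]^m + ℤ^m`: the line
`{u + t α | t ∈ ℝ}` meets that lattice arrangement of cubes; equivalently, modulo `ℤ^m`, the line
in the torus `ℝ^m / ℤ^m` meets the image of the cube `[ε, 1 - ε]^m`. -/
def ViewObstructed {m : ℕ} (u α : Fin m → ℝ) (ε : ℝ) : Prop :=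
  ∃ t : ℝ, ∃ k : Fin m → ℤ, ∀ i, u i + t * α i - (k i : ℝ) ∈ Set.Icc ε (1 - ε)

/-- The numbers `0 ≤ ε ≤ 1/2` such that, for every starting point `u` and every nontrivial
direction `α` (all coordinates nonzero) with `dim_ℚ(α) ≥ m - n`, the view from `u` with
direction `α` is obstructed by `[ε, 1 - ε]^m + ℤ^m`. -/
def admissibleEps (n m : ℕ) : Set ℝ :=
  {ε : ℝ | 0 ≤ ε ∧ ε ≤ 1 / 2 ∧
    ∀ u α : Fin m → ℝ, (∀ i, α i ≠ 0) → m ≤ n + ratDim α → ViewObstructed u α ε}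

/-- The supremum `ε̄(n, m)` of the admissible `ε`. -/
noncomputable def barEps (n m : ℕ) : ℝ := sSup (admissibleEps n m)

/-- The supremum defining `ε̄(n, m)` is over a nonempty set. -/
theorem admissibleEps_nonempty (n m : ℕ) : (admissibleEps n m).Nonempty := by
  refine ⟨0, le_rfl, by norm_num, fun u α _ _ => ⟨0, fun i => ⌊u i⌋, fun i => ?_⟩⟩
  have h1 := Int.floor_le (u i)
  have h2 := Int.lt_floor_add_one (u i)
  constructor <;> linarith

/-- The supremum defining `ε̄(n, m)` is over a set that is bounded above. -/
theorem admissibleEps_bddAbove (n m : ℕ) : BddAbove (admissibleEps n m) :=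
  ⟨1 / 2, fun _ h => h.2.1⟩

open MeasureTheory Filter Topology Set

/-! Monotonicity: a coordinate of `α` outside the rational span of the others raises the number of
coordinates and the rank together. Upper bound: `n + 1` equally spaced points moving at equal speed
always leave one near an integer; monotonicity carries this from `m = n + 1` to larger `m`.

Lower bound: by Kronecker's theorem, `t * α j` can be replaced modulo one, up to arbitrarily small
error, by `φ (α j)` for any additive `φ` (`exists_mul_approx_addMonoidHom`). A `ℚ`-linear `φ`
keeping every `u j + φ (α j)` away from the integers is built by induction
(`exists_linearMap_lt_norm`): each parallel class has at most `n + 1` members, which a measure bound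
on the circle handles, and projecting along that direction leaves fewer vectors with excess over the
rank still at most `n`. -/

instance UnitAddCircle.isProbabilityMeasure_volume :
    IsProbabilityMeasure (volume : Measure UnitAddCircle) :=
  ⟨UnitAddCircle.measure_univ⟩

/-! ### Equidistribution and density of linear flows on the torus. -/

theorem UnitAddTorus.integral_mFourier {d : Type*} [Fintype d] {n : d → ℤ} (hn : n ≠ 0) :
    ∫ x : UnitAddTorus d, UnitAddTorus.mFourier n x = 0 := by
  obtain ⟨i, hi⟩ := Function.ne_iff.mp hn
  simp only [UnitAddTorus.mFourier, ContinuousMap.coe_mk]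
  rw [integral_fintype_prod_volume_eq_prod]
  exact Finset.prod_eq_zero (Finset.mem_univ i)
    (integral_eq_zero_of_add_right_eq_neg (fourier_add_half_inv_index hi one_pos))

theorem tendsto_average_exp {c : ℝ} (hc : c ≠ 0) :
    Tendsto (fun T : ℝ => (T⁻¹ : ℂ) * ∫ t in (0 : ℝ)..T, Complex.exp (c * Complex.I * t)) atTop
      (𝓝 0) := by
  have hc' : (c : ℂ) * Complex.I ≠ 0 := by simp [hc]
  have h0 : Tendsto (fun T : ℝ => T⁻¹ * (2 / |c|)) atTop (𝓝 0) := by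
    simpa using tendsto_inv_atTop_zero.mul_const (2 / |c|)
  refine squeeze_zero_norm' ?_ h0
  filter_upwards [eventually_gt_atTop 0] with T hT
  rw [integral_exp_mul_complex hc', norm_mul, norm_inv, norm_div]
  have h1 : ‖Complex.exp (c * Complex.I * T) - Complex.exp (c * Complex.I * (0 : ℝ))‖ ≤ 2 := by
    refine (norm_sub_le _ _).trans ?_
    have := Complex.norm_exp_ofReal_mul_I (c * T)
    push_cast at this
    rw [show (c : ℂ) * Complex.I * T = c * T * Complex.I by ring, this]
    simp
    norm_num
  simp only [Complex.norm_real, Real.norm_eq_abs, abs_of_pos hT, norm_mul, Complex.norm_I, mul_one]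
  gcongr

theorem UnitAddTorus.mFourier_apply_coe {d : Type*} [Fintype d] (n : d → ℤ) (β : d → ℝ) (t : ℝ) :
    UnitAddTorus.mFourier n (fun i => ((t * β i : ℝ) : UnitAddCircle)) =
      Complex.exp (((2 * Real.pi * ∑ i, n i * β i : ℝ) : ℂ) * Complex.I * t) := by
  simp only [UnitAddTorus.mFourier, ContinuousMap.coe_mk, fourier_coe_apply]
  rw [← Complex.exp_sum]
  congr 1
  push_cast
  simp only [Finset.mul_sum, Finset.sum_mul]
  refine Finset.sum_congr rfl fun i _ => ?_
  simp
  ring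

/-- **Weyl's criterion for linear flows**: the averages of a trigonometric polynomial along a
line with `ℤ`-independent direction converge to its integral. -/
theorem UnitAddTorus.tendsto_average_of_mem_span {d : Type*} [Fintype d] {β : d → ℝ}
    (hβ : LinearIndependent ℤ β) {g : C(UnitAddTorus d, ℂ)}
    (hg : g ∈ Submodule.span ℂ (range (UnitAddTorus.mFourier (d := d)))) :
    Tendsto (fun T : ℝ => (T⁻¹ : ℂ) *
      ∫ t in (0 : ℝ)..T, g (fun i => ((t * β i : ℝ) : UnitAddCircle))) atTop (𝓝 (∫ x, g x)) := by
  have hcont : Continuous fun (t : ℝ) (i : d) => ((t * β i : ℝ) : UnitAddCircle) :=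
    continuous_pi fun i => (AddCircle.continuous_mk' 1).comp (by fun_prop)
  have hI (g : C(UnitAddTorus d, ℂ)) (a b : ℝ) : IntervalIntegrable
      (fun t : ℝ => g (fun i => ((t * β i : ℝ) : UnitAddCircle))) volume a b :=
    (g.continuous.comp hcont).intervalIntegrable _ _
  have hJ (g : C(UnitAddTorus d, ℂ)) : Integrable (fun x => g x) :=
    g.continuous.integrable_of_hasCompactSupport (HasCompactSupport.of_compactSpace _)
  induction hg using Submodule.span_induction with
  | mem g hg =>
    obtain ⟨n, rfl⟩ := hg
    by_cases hn : n = 0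
    · subst hn
      have h1 : ∫ x, UnitAddTorus.mFourier (0 : d → ℤ) x = 1 := by
        simp [UnitAddTorus.mFourier_zero]
      rw [h1]
      refine tendsto_const_nhds.congr' ?_
      filter_upwards [eventually_gt_atTop 0] with T hT
      have hT' : (T : ℂ) ≠ 0 := by exact_mod_cast hT.ne'
      simp [UnitAddTorus.mFourier_zero, hT']
    · rw [UnitAddTorus.integral_mFourier hn]
      simp only [UnitAddTorus.mFourier_apply_coe]
      apply tendsto_average_exp
      -- Independence of `β` makes the frequency of a nontrivial character nonzero along the line.
      refine mul_ne_zero (by positivity) fun h => hn ?_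
      funext i
      exact Fintype.linearIndependent_iff.mp hβ n (by simpa using h) i
  | zero => simp
  | add f g _ _ hf hg =>
    simp only [ContinuousMap.add_apply]
    rw [integral_add (hJ f) (hJ g)]
    refine (hf.add hg).congr fun T => ?_
    rw [intervalIntegral.integral_add (hI f _ _) (hI g _ _), mul_add]
  | smul c f _ hf =>
    simp only [ContinuousMap.smul_apply, smul_eq_mul, integral_const_mul,
      intervalIntegral.integral_const_mul]
    refine (hf.const_mul c).congr fun T => ?_
    ring

/-- **Kronecker's theorem** for one-parameter flows on the torus. -/
theorem UnitAddTorus.denseRange_line {d : Type*} [Fintype d] {β : d → ℝ}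
    (hβ : LinearIndependent ℤ β) :
    DenseRange fun (t : ℝ) (i : d) => ((t * β i : ℝ) : UnitAddCircle) := by
  set L : ℝ → UnitAddTorus d := fun t i => ((t * β i : ℝ) : UnitAddCircle) with hL
  have hcont : Continuous L :=
    continuous_pi fun i => (AddCircle.continuous_mk' 1).comp (by fun_prop)
  intro y
  by_contra hy
  -- The distance to the line vanishes along it, yet has positive integral if `y` is outside the
  -- closure. A trigonometric polynomial within `J / 2` of it contradicts Weyl's criterion.
  let f : C(UnitAddTorus d, ℂ) :=
    ⟨fun x => (Metric.infDist x (range L) : ℂ),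
      Complex.continuous_ofReal.comp (Metric.continuous_infDist_pt _)⟩
  have hfL (t : ℝ) : f (L t) = 0 := by
    simp [f, Metric.infDist_zero_of_mem (mem_range_self t)]
  have hpos : 0 < ∫ x : UnitAddTorus d, Metric.infDist x (range L) := by
    refine (Metric.continuous_infDist_pt _).integral_pos_of_hasCompactSupport_nonneg_nonzero
      (HasCompactSupport.of_compactSpace _) (fun x => Metric.infDist_nonneg) (x := y) ?_
    intro h
    exact hy ((Metric.mem_closure_iff_infDist_zero (range_nonempty L)).mpr h)
  set J := ∫ x : UnitAddTorus d, Metric.infDist x (range L) with hJ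
  have hfJ : ∫ x, f x = (J : ℂ) := integral_ofReal
  have hmem : f ∈ closure (Submodule.span ℂ (range (UnitAddTorus.mFourier (d := d))) :
      Set C(UnitAddTorus d, ℂ)) := by
    rw [← Submodule.topologicalClosure_coe, UnitAddTorus.span_mFourier_closure_eq_top]
    trivial
  obtain ⟨g, hg, hfg⟩ := Metric.mem_closure_iff.mp hmem (J / 2) (by positivity)
  rw [dist_eq_norm] at hfg
  have hgx (x) : ‖f x - g x‖ ≤ ‖f - g‖ := (f - g).norm_coe_le_norm x
  have hI (g : C(UnitAddTorus d, ℂ)) : Integrable (fun x => g x) :=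
    g.continuous.integrable_of_hasCompactSupport (HasCompactSupport.of_compactSpace _)
  have h1 : ‖(J : ℂ) - ∫ x, g x‖ ≤ ‖f - g‖ := by
    rw [← hfJ, ← integral_sub (hI f) (hI g)]
    simpa using norm_integral_le_of_norm_le_const (μ := (volume : Measure (UnitAddTorus d)))
      (Eventually.of_forall hgx)
  have h2 : ‖∫ x, g x‖ ≤ ‖f - g‖ := by
    refine le_of_tendsto (UnitAddTorus.tendsto_average_of_mem_span hβ hg).norm ?_
    filter_upwards [eventually_gt_atTop 0] with T hT
    have h3 : ‖∫ t in (0 : ℝ)..T, g (L t)‖ ≤ ‖f - g‖ * |T - 0| :=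
      intervalIntegral.norm_integral_le_of_norm_le_const fun t _ => by
        simpa [hfL] using hgx (L t)
    rw [norm_mul, norm_inv, Complex.norm_real, Real.norm_eq_abs, inv_mul_le_iff₀ (by positivity)]
    rw [sub_zero] at h3
    linarith
  have h4 : ‖(J : ℂ)‖ ≤ ‖(J : ℂ) - ∫ x, g x‖ + ‖∫ x, g x‖ := by
    simpa using norm_add_le ((J : ℂ) - ∫ x, g x) (∫ x, g x)
  rw [Complex.norm_real, Real.norm_eq_abs, abs_of_pos hpos] at h4
  linarith

/-- Every additive map on the reals is approximated modulo one by homotheties on a finite set. -/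
theorem exists_mul_approx_addMonoidHom {ι : Type*} [Finite ι] (α : ι → ℝ) (φ : ℝ →+ ℝ) {δ : ℝ}
    (hδ : 0 < δ) : ∃ t : ℝ, ∀ j, ‖((t * α j - φ (α j) : ℝ) : UnitAddCircle)‖ < δ := by
  cases nonempty_fintype ι
  let A := Submodule.span ℤ (range α)
  have : Module.Finite ℤ A := Module.Finite.span_of_finite ℤ (finite_range α)
  have : Module.Free ℤ A := Module.free_of_finite_type_torsion_free'
  let b := Module.Free.chooseBasis ℤ A
  let β : Module.Free.ChooseBasisIndex ℤ A → ℝ := fun i => (b i : ℝ)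
  have hβ : LinearIndependent ℤ β :=
    b.linearIndependent.map' A.subtype (Submodule.ker_subtype A)
  let a : ι → A := fun j => ⟨α j, Submodule.subset_span (mem_range_self j)⟩
  have hα (j : ι) : α j = ∑ i, b.repr (a j) i • β i := by
    have := congrArg (A.subtype) (b.sum_repr (a j))
    rw [map_sum] at this
    exact this.symm
  let F : UnitAddTorus (Module.Free.ChooseBasisIndex ℤ A) → (ι → UnitAddCircle) :=
    fun y j => ∑ i, b.repr (a j) i • y i
  have hF : Continuous F := by fun_prop
  have hFφ : F (fun i => (φ (β i) : UnitAddCircle)) = fun j => (φ (α j) : UnitAddCircle) := by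
    funext j
    rw [hα j]
    simp only [F, map_sum, map_zsmul]
    exact (map_sum (QuotientAddGroup.mk' (AddSubgroup.zmultiples (1 : ℝ))) _ _).symm
  have hFt (t : ℝ) : F (fun i => ((t * β i : ℝ) : UnitAddCircle)) =
      fun j => ((t * α j : ℝ) : UnitAddCircle) := by
    funext j
    rw [hα j]
    simp only [F, Finset.mul_sum, mul_smul_comm]
    exact (map_sum (QuotientAddGroup.mk' (AddSubgroup.zmultiples (1 : ℝ))) _ _).symm
  obtain ⟨t, ht⟩ := (UnitAddTorus.denseRange_line hβ).exists_mem_open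
    (Metric.isOpen_ball.preimage hF :
      IsOpen (F ⁻¹' Metric.ball (fun j => (φ (α j) : UnitAddCircle)) δ))
    ⟨fun i => (φ (β i) : UnitAddCircle), by simp [hFφ, hδ]⟩
  refine ⟨t, fun j => ?_⟩
  rw [mem_preimage, hFt, mem_ball_iff_norm] at ht
  exact (norm_le_pi_norm _ j).trans_lt ht

/-! ### Keeping points of the circle away from the origin. -/

theorem UnitAddCircle.measurePreserving_zsmul_add {n : ℤ} (hn : n ≠ 0) (x : UnitAddCircle) :
    MeasurePreserving (fun y : UnitAddCircle => x + n • y) volume volume :=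
  (measurePreserving_add_left volume x).comp (Measure.measurePreserving_zsmul volume hn)

/-- Finitely many points rotating with nonzero integer speeds on the circle are simultaneously
at distance more than `ε` from the origin, as soon as their number times `2ε` is less than `1`. -/
theorem exists_forall_lt_norm_add_zsmul {ι : Type*} (s : Finset ι) (u : ι → UnitAddCircle)
    (r : ι → ℤ) (hr : ∀ j ∈ s, r j ≠ 0) {ε : ℝ} (hs : s.card * (2 * ε) < 1) :
    ∃ x : UnitAddCircle, ∀ j ∈ s, ε < ‖u j + r j • x‖ := by
  -- Otherwise the bad sets, each of measure at most `2 * ε`, would cover a circle of measure one.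
  by_contra! h
  have hU : (univ : Set UnitAddCircle) ⊆
      ⋃ j ∈ s, (fun y : UnitAddCircle => u j + r j • y) ⁻¹' Metric.closedBall 0 ε := by
    intro x _
    obtain ⟨j, hj, hx⟩ := h x
    simp only [mem_iUnion]
    exact ⟨j, hj, by simpa using hx⟩
  have h1 := (measure_mono (μ := volume) hU).trans (measure_biUnion_finset_le s _)
  have h2 : ∀ j ∈ s, volume ((fun y : UnitAddCircle => u j + r j • y) ⁻¹' Metric.closedBall 0 ε) ≤
      ENNReal.ofReal (2 * ε) := by
    intro j hj
    rw [(UnitAddCircle.measurePreserving_zsmul_add (hr j hj) (u j)).measure_preimage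
      Metric.isClosed_closedBall.nullMeasurableSet, AddCircle.volume_closedBall]
    exact ENNReal.ofReal_le_ofReal (min_le_right _ _)
  have h3 := h1.trans (Finset.sum_le_sum h2)
  rw [UnitAddCircle.measure_univ, Finset.sum_const, nsmul_eq_mul, ← ENNReal.ofReal_natCast,
    ← ENNReal.ofReal_mul (by positivity), ENNReal.one_le_ofReal] at h3
  linarith

/-- The version with rational speeds. -/
theorem exists_forall_lt_norm_add_mul_rat {ι : Type*} (s : Finset ι) (u : ι → ℝ)
    (r : ι → ℚ) (hr : ∀ j ∈ s, r j ≠ 0) {ε : ℝ} (hs : s.card * (2 * ε) < 1) :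
    ∃ x : ℝ, ∀ j ∈ s, ε < ‖((u j + r j * x : ℝ) : UnitAddCircle)‖ := by
  obtain ⟨⟨N, hN⟩, hNr⟩ := IsLocalization.exist_integer_multiples (nonZeroDivisors ℤ) s r
  have hN0 : N ≠ 0 := nonZeroDivisors.ne_zero hN
  choose! z hz using hNr
  have hz' : ∀ j ∈ s, ((z j : ℚ)) = N * r j := fun j hj => by
    simpa [Algebra.smul_def] using hz j hj
  obtain ⟨x, hx⟩ := exists_forall_lt_norm_add_zsmul s (fun j => (u j : UnitAddCircle)) z
    (fun j hj h => by
      have := hz' j hj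
      rw [h, Int.cast_zero, eq_comm, mul_eq_zero] at this
      exact this.elim (by exact_mod_cast hN0) (hr j hj)) hs
  obtain ⟨x, rfl⟩ := QuotientAddGroup.mk_surjective x
  refine ⟨N * x, fun j hj => ?_⟩
  have h1 : (r j : ℝ) * (N * x) = z j • x := by
    have : (z j : ℝ) = N * r j := by exact_mod_cast hz' j hj
    rw [zsmul_eq_mul, this]
    ring
  rw [h1]
  exact hx j hj

/-- If finitely many nonzero vectors of a rational vector space have excess `n` over their rank
and `2ε(n + 1) < 1`, then any translates of them are sent by some functional to reals at distance
more than `ε` from the integers. -/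
theorem exists_linearMap_lt_norm {E ι : Type*} [AddCommGroup E] [Module ℚ E] (n : ℕ) {ε : ℝ}
    (hε : 0 ≤ ε) (hn : ((n : ℝ) + 1) * (2 * ε) < 1) (s : Finset ι) (v : ι → E) (u : ι → ℝ)
    (hv : ∀ j ∈ s, v j ≠ 0)
    (hs : s.card ≤ n + Module.finrank ℚ (Submodule.span ℚ (v '' s))) :
    ∃ φ : E →ₗ[ℚ] ℝ, ∀ j ∈ s, ε < ‖((u j + φ (v j) : ℝ) : UnitAddCircle)‖ := by
  classical
  induction hk : s.card using Nat.strong_induction_on generalizing s v u with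
  | _ k ih =>
  obtain rfl | ⟨j₀, hj₀⟩ := s.eq_empty_or_nonempty
  · exact ⟨0, by simp⟩
  obtain ⟨f, hf⟩ := Module.Projective.exists_dual_ne_zero ℚ (hv j₀ hj₀)
  obtain ⟨f, hf⟩ : ∃ f : E →ₗ[ℚ] ℚ, f (v j₀) = 1 :=
    ⟨(f (v j₀))⁻¹ • f, by simp [inv_mul_cancel₀ hf]⟩
  -- The projection along `v j₀`: it kills exactly the multiples of `v j₀`, so `c` is the parallel
  -- class of `j₀`.
  let p : E →ₗ[ℚ] E := LinearMap.id - f.smulRight (v j₀)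
  have hp (x : E) : p x = x - f x • v j₀ := rfl
  set s' := s.filter fun j => p (v j) ≠ 0 with hs'
  set c := s.filter fun j => p (v j) = 0 with hc
  have hcard : c.card + s'.card = s.card := Finset.card_filter_add_card_filter_not _
  have hj₀c : j₀ ∈ c := by simp [hc, hj₀, hp, hf]
  have hcpos : 0 < c.card := Finset.card_pos.mpr ⟨j₀, hj₀c⟩
  set W := Submodule.span ℚ (v '' s) with hW
  have : FiniteDimensional ℚ W := FiniteDimensional.span_of_finite ℚ (s.finite_toSet.image v)
  have hspan : Submodule.span ℚ ((p ∘ v) '' s') = W.map p := by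
    rw [hW, Submodule.map_span, ← image_comp]
    apply le_antisymm
    · exact Submodule.span_mono (image_mono (Finset.coe_subset.mpr (Finset.filter_subset _ _)))
    · rw [Submodule.span_le]
      rintro _ ⟨j, hj, rfl⟩
      by_cases h : p (v j) = 0
      · simp [h]
      · exact Submodule.subset_span ⟨j, by simpa [hs', h] using hj, rfl⟩
  have hrank : Module.finrank ℚ W ≤ Module.finrank ℚ (W.map p) + 1 := by
    have h1 := (p.domRestrict W).finrank_range_add_finrank_ker
    rw [LinearMap.range_domRestrict] at h1
    have h2 : Module.finrank ℚ (LinearMap.ker (p.domRestrict W)) ≤ 1 := by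
      refine finrank_le_one ⟨⟨v j₀, Submodule.subset_span ⟨j₀, hj₀, rfl⟩⟩, ?_⟩ fun w => ⟨f w, ?_⟩
      · simp [hp, hf]
      · have := w.2
        rw [LinearMap.mem_ker, LinearMap.domRestrict_apply, hp, sub_eq_zero] at this
        ext
        exact this.symm
    omega
  have hs'rank : Module.finrank ℚ (W.map p) ≤ s'.card := by
    rw [← hspan]
    have := finrank_span_finset_le_card (R := ℚ) (s'.image (p ∘ v))
    rw [Set.finrank, Finset.coe_image] at this
    exact this.trans Finset.card_image_le
  -- The rank drops by at most one under `p`, and the rank that remains is at most `s'.card`.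
  have hcn : (c.card : ℝ) ≤ n + 1 := by
    have : c.card ≤ n + 1 := by omega
    exact_mod_cast this
  have hcv : ∀ j ∈ c, v j = f (v j) • v j₀ := fun j hj => by
    have := (Finset.mem_filter.mp hj).2
    rwa [hp, sub_eq_zero] at this
  obtain ⟨x, hx⟩ := exists_forall_lt_norm_add_mul_rat c u (fun j => f (v j))
    (fun j hj h => hv j (Finset.mem_filter.mp hj).1 (by rw [hcv j hj, h, zero_smul]))
    ((mul_le_mul_of_nonneg_right hcn (by positivity)).trans_lt hn)
  -- The value `x` assigned to `v j₀` settles `c`; for the other vectors it is absorbed into the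
  -- translates.
  obtain ⟨ψ, hψ⟩ := ih s'.card (by omega) s' (p ∘ v) (fun j => u j + f (v j) * x)
    (fun j hj => (Finset.mem_filter.mp hj).2) (by rw [hspan]; omega) rfl
  refine ⟨f.smulRight x + ψ ∘ₗ p, fun j hj => ?_⟩
  have hval : (f.smulRight x + ψ ∘ₗ p) (v j) = f (v j) * x + ψ (p (v j)) := by
    simp [Rat.smul_def]
  rw [hval]
  by_cases h : p (v j) = 0
  · rw [h, map_zero, add_zero]
    exact hx j (Finset.mem_filter.mpr ⟨hj, h⟩)
  · rw [← add_assoc]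
    exact hψ j (Finset.mem_filter.mpr ⟨hj, h⟩)

/-! ### The lower bound. -/

theorem viewObstructed_of_forall_le_norm {m : ℕ} {u α : Fin m → ℝ} {ε : ℝ} (t : ℝ)
    (h : ∀ i, ε ≤ ‖((u i + t * α i : ℝ) : UnitAddCircle)‖) : ViewObstructed u α ε := by
  refine ⟨t, fun i => ⌊u i + t * α i⌋, fun i => ?_⟩
  have h1 := h i
  rw [UnitAddCircle.norm_eq] at h1
  have h2 := h1.trans (round_le (u i + t * α i) ⌊u i + t * α i⌋)
  have h3 := h1.trans (round_le (u i + t * α i) (⌊u i + t * α i⌋ + 1))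
  have h4 := Int.floor_le (u i + t * α i)
  have h5 := Int.lt_floor_add_one (u i + t * α i)
  rw [abs_of_nonneg (by linarith)] at h2
  push_cast at h3
  rw [abs_of_nonpos (by linarith)] at h3
  constructor <;> linarith

theorem mem_admissibleEps_of_lt {n m : ℕ} {ε : ℝ} (hε : 0 ≤ ε)
    (hn : ε < 1 / (2 * ((n : ℝ) + 1))) : ε ∈ admissibleEps n m := by
  have hn0 : (0 : ℝ) ≤ n := n.cast_nonneg
  refine ⟨hε, hn.le.trans ?_, fun u α hα hdim => ?_⟩
  · gcongr
    linarith
  -- The gap `ε' - ε` pays for the Kronecker approximation error.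
  obtain ⟨ε', hεε', hε'⟩ := exists_between hn
  obtain ⟨φ, hφ⟩ := exists_linearMap_lt_norm (E := ℝ) n (ε := ε') (by linarith)
    (by rw [lt_div_iff₀ (by positivity)] at hε'; linarith) Finset.univ α u (fun j _ => hα j)
    (by rwa [Finset.coe_univ, image_univ, Finset.card_fin])
  obtain ⟨t, ht⟩ := exists_mul_approx_addMonoidHom α φ.toAddMonoidHom (sub_pos.mpr hεε')
  refine viewObstructed_of_forall_le_norm t fun i => ?_
  have h1 := norm_sub_le ((u i + t * α i : ℝ) : UnitAddCircle)
    ((t * α i - φ (α i) : ℝ) : UnitAddCircle)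
  rw [← AddCircle.coe_sub, show u i + t * α i - (t * α i - φ (α i)) = u i + φ (α i) by ring] at h1
  have h2 := hφ i (Finset.mem_univ i)
  have h3 := ht i
  simp only [LinearMap.toAddMonoidHom_coe] at h3
  linarith

/-! ### Monotonicity and the upper bound. -/

theorem exists_notMem_span_rat {m : ℕ} (α : Fin m → ℝ) :
    ∃ x : ℝ, x ∉ Submodule.span ℚ (range α) := by
  by_contra! h
  have htop : Submodule.span ℚ (range α) = ⊤ := eq_top_iff.mpr fun x _ => h x
  -- A finite-dimensional rational space is countable, unlike `ℝ`.
  have hfin : Module.Finite ℚ ℝ := ⟨⟨Finset.univ.image α, by simpa using htop⟩⟩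
  have hc : Countable ℝ := (Module.finBasis ℚ ℝ).equivFun.injective.countable
  exact not_countable hc

theorem ratDim_snoc {m : ℕ} (α : Fin m → ℝ) {x : ℝ} (hx : x ∉ Submodule.span ℚ (range α)) :
    ratDim α + 1 ≤ ratDim (Fin.snoc α x : Fin (m + 1) → ℝ) := by
  have hr : range (Fin.snoc α x : Fin (m + 1) → ℝ) = insert x (range α) := by
    simp [Fin.range_snoc]
  rw [ratDim, ratDim, hr]
  have : FiniteDimensional ℚ (Submodule.span ℚ (insert x (range α))) :=
    FiniteDimensional.span_of_finite ℚ ((finite_range α).insert x)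
  refine Submodule.finrank_lt_finrank_of_lt (lt_of_le_of_ne
    (Submodule.span_mono (subset_insert _ _)) fun h => hx ?_)
  rw [h]
  exact Submodule.subset_span (mem_insert _ _)

theorem admissibleEps_succ_subset (n m : ℕ) : admissibleEps n (m + 1) ⊆ admissibleEps n m := by
  rintro ε ⟨h0, h1, h⟩
  refine ⟨h0, h1, fun u α hα hdim => ?_⟩
  obtain ⟨x, hx⟩ := exists_notMem_span_rat α
  have hx0 : x ≠ 0 := fun h => hx (h ▸ zero_mem _)
  have := ratDim_snoc α hx
  obtain ⟨t, k, htk⟩ := h (Fin.snoc u 0) (Fin.snoc α x)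
    (Fin.lastCases (by simpa using hx0) (by simpa using hα)) (by omega)
  exact ⟨t, fun i => k i.castSucc, fun i => by simpa using htk i.castSucc⟩

theorem barEps_succ_le (n m : ℕ) : barEps n (m + 1) ≤ barEps n m :=
  csSup_le_csSup (admissibleEps_bddAbove n m) (admissibleEps_nonempty n (m + 1))
    (admissibleEps_succ_subset n m)

/-- Among `n + 1` equally spaced points of the circle, one is within `1 / (2(n + 1))` of `0`. -/
theorem barEps_self_succ_le (n : ℕ) : barEps n (n + 1) ≤ 1 / (2 * ((n : ℝ) + 1)) := by
  refine csSup_le (admissibleEps_nonempty _ _) fun ε hε => ?_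
  have hN : (0 : ℝ) < (n : ℝ) + 1 := by positivity
  have hd : 1 ≤ ratDim (fun _ : Fin (n + 1) => (1 : ℝ)) := by
    rw [ratDim, range_const, finrank_span_singleton one_ne_zero]
  obtain ⟨t, k, htk⟩ := hε.2.2 (fun i : Fin (n + 1) => (i : ℝ) / (n + 1)) (fun _ => 1)
    (fun _ => one_ne_zero) (by omega)
  set r := round (t * (n + 1)) with hr
  have hround := abs_le.mp (abs_sub_round (t * ((n : ℝ) + 1)))
  rw [← hr] at hround
  -- the index `i ≡ -r` modulo `n + 1`
  have hmod0 := Int.emod_nonneg (-r) (b := (n : ℤ) + 1) (by omega)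
  have hmod1 := Int.emod_lt_of_pos (-r) (b := (n : ℤ) + 1) (by omega)
  have hdiv := Int.mul_ediv_add_emod (-r) (n + 1)
  set q := (-r) / ((n : ℤ) + 1)
  obtain ⟨i, hi⟩ := Int.eq_ofNat_of_zero_le hmod0
  rw [hi] at hmod1 hdiv
  have hR : ((n : ℝ) + 1) * q + i = -r := by exact_mod_cast hdiv
  have hik := htk ⟨i, by omega⟩
  simp only [mul_one, mem_Icc] at hik
  set K := k ⟨i, by omega⟩
  have e1 : (i : ℝ) / (n + 1) + t = -q + (t * (n + 1) - r) / (n + 1) := by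
    field_simp
    linarith
  rw [e1] at hik
  have hlo : -(1 / (2 * ((n : ℝ) + 1))) ≤ (t * (n + 1) - r) / (n + 1) := by
    rw [le_div_iff₀ hN]
    field_simp
    linarith [hround.1]
  have hhi : (t * (n + 1) - r) / (n + 1) ≤ 1 / (2 * ((n : ℝ) + 1)) := by
    rw [div_le_iff₀ hN]
    field_simp
    linarith [hround.2]
  -- Coordinate `i` is within `1 / (2 * (n + 1))` of the integer `-q`, which lies at or below `K` or
  -- at or above `K + 1`; either way this bounds `ε`.
  rcases le_or_gt (-q) K with h | h
  · have : -(q : ℝ) ≤ K := by exact_mod_cast h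
    linarith
  · have : (K : ℝ) + 1 ≤ -q := by exact_mod_cast h
    linarith

theorem proposition3p7 (n m : ℕ) (hnm : n ≤ m) :
    barEps n (m + 1) ≤ barEps n m ∧
      (n < m → barEps n m = 1 / (2 * ((n : ℝ) + 1))) := by
  refine ⟨barEps_succ_le n m, fun h => le_antisymm ?_ ?_⟩
  · exact (antitone_nat_of_succ_le (barEps_succ_le n) h).trans (barEps_self_succ_le n)
  · refine le_of_forall_lt_imp_le_of_dense fun ε hε => ?_
    have h0 : (0 : ℝ) < 1 / (2 * ((n : ℝ) + 1)) := by positivity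
    -- Here `ε` may be negative, so `max ε 0` serves as the admissible value.
    exact (le_max_left ε 0).trans
      (le_csSup (admissibleEps_bddAbove n m)
        (mem_admissibleEps_of_lt (le_max_right _ _) (max_lt hε h0)))
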